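/- Let $(\Omega,\mathcal F,\mathbb P)$ be a probability space. For each $n\ge 1$ let $\Sigma^n\in\mathbb R^{n\times n}$ be a (symmetric, positive semidefinite, possibly singular) covariance matrix with nonzero diagonal entries, and let $\zeta^n=(\zeta^n_1,\dots,\zeta^n_n)$ be a Gaussian vector on $\Omega$ with $\zeta^n\sim\mathcal N(0,\Sigma^n)$; the joint distribution of different rows is arbitrary. Suppose that for some constant $R>0$ independent of $n$, \[ \sum_{1\le\alpha<\beta\le n}\frac{(\Sigma^n_{\alpha\beta})^2}{\Sigma^n_{\alpha\alpha}\Sigma^n_{\beta\beta}}\le R\qquad\text{for all } n\ge 1 . \] For $n\ge1$ and $1\le\alpha\le n$ let $\phi^n_\alpha:\mathbb R\to\mathbb R$ be a (Lebesgue) measurable function such that $\phi^n_\alpha(\zeta^n_\alpha)$ is integrable, with mean $\mu^n_\alpha=\mathbb E\,\phi^n_\alpha(\zeta^n_\alpha)$. Assume that at least one of the following two conditions holds: \begin{itemize} \item for some real $p\ge 6$ and some $S$ independent of $n$ and $\alpha$, $\ \mathbb E\,|\phi^n_\alpha(\zeta^n_\alpha)-\mu^n_\alpha|^{2p}\le S$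 for all $n\ge1$ and all $1\le\alpha\le n$; \item for some real $q>12$ and some $S$ independent of $n$, $\ \frac1n\sum_{\alpha=1}^n\mathbb E\,|\phi^n_\alpha(\zeta^n_\alpha)-\mu^n_\alpha|^{2q}<S$ for all $n\ge1$. \end{itemize} Then, as $n\to\infty$, \[ \frac1n\sum_{\alpha=1}^n\bigl(\phi^n_\alpha(\zeta^n_\alpha)-\mu^n_\alpha\bigr)\longrightarrow 0\qquad\text{almost surely.} \] -/

import Mathlib

open Filter Topology MeasureTheory ProbabilityTheory

/-! The indices split into boundedly many blocks on which the Gaussian vector is almost independent.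
If the correlation matrix `C` of a block satisfies `‖C - 1‖² ≤ 1/2` in Frobenius norm, the density
of `N(0, C)` against the standard Gaussian law `γ` has squared `L²(γ)` norm at most `exp ‖C - 1‖² ≤
2`, whatever the dimension. Cauchy–Schwarz then bounds the square of a probability by twice its
`γ`-probability (`sq_multivariateGaussian_le`).

Under `γ` the summands are independent and centered, so their sum has sixth moment `O(n³)` and
exceeds `ε n` with probability `O(n⁻³)`. The comparison takes a square root, leaving the summable
`n^(-3/2)`; fourth moments would give only `n⁻¹`.

The total squared correlation is bounded by `R`, not by `1/2`. A colouring with `K ≥ 4 R` colours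
(`exists_coloring_sum_le`) makes every block small enough, and the union bound costs a factor
independent of `n`. Borel–Cantelli uses each row separately, so the joint law of the rows plays no
role. -/

/-! ### Comparison of nearly standard Gaussian laws with the standard one. -/

open scoped ENNReal NNReal in
/-- Cauchy–Schwarz against the density of `N(0, v)` with respect to `N(0, 1)`. -/
theorem sq_lintegral_gaussianReal_le (v : ℝ≥0) (hv : ((v : ℝ) - 1) ^ 2 ≤ 1 / 2)
    (g : ℝ → ℝ≥0∞) (hg : Measurable g) :
    (∫⁻ x, g x ∂gaussianReal 0 v) ^ 2 ≤
      ENNReal.ofReal (Real.exp (((v : ℝ) - 1) ^ 2)) * ∫⁻ x, g x ^ 2 ∂gaussianReal 0 1 := by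
  have hv0 : (0 : ℝ) < v := by
    by_contra h
    nlinarith
  have hv2 : (0 : ℝ) < 2 - v := by nlinarith
  have hvne : v ≠ 0 := by
    rintro rfl
    simp at hv0
  -- Chosen so that `2 / v = 1 / w + 1`: the squared density of `N(0, v)` is then `k` times the
  -- product of the densities of `N(0, w)` and `N(0, 1)`.
  obtain ⟨w, hw⟩ : ∃ w : ℝ≥0, (w : ℝ) = v / (2 - v) := ⟨⟨v / (2 - v), by positivity⟩, rfl⟩
  have hw0 : (0 : ℝ) < w := by rw [hw]; positivity
  have hwne : w ≠ 0 := by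
    rintro rfl
    simp at hw0
  set k : ℝ := √w / v with hk
  have hk0 : 0 ≤ k := by positivity
  have key : ∀ x, gaussianPDFReal 0 v x ^ 2 =
      k * gaussianPDFReal 0 w x * gaussianPDFReal 0 1 x := by
    intro x
    simp only [gaussianPDFReal_def, NNReal.coe_one, mul_one, sub_zero, hk]
    have e : Real.exp (-x ^ 2 / (2 * v)) ^ 2 =
        Real.exp (-x ^ 2 / (2 * w)) * Real.exp (-x ^ 2 / 2) := by
      rw [← Real.exp_add, ← Real.exp_nat_mul]
      congr 1
      rw [hw]
      field_simp
      ring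
    have s : √(2 * Real.pi * w) = √(2 * Real.pi) * √w := Real.sqrt_mul (by positivity) _
    have s1 : √(2 * Real.pi * v) ^ 2 = 2 * Real.pi * v := Real.sq_sqrt (by positivity)
    have s2 : √(2 * Real.pi) ^ 2 = 2 * Real.pi := Real.sq_sqrt (by positivity)
    have s3 : 0 < √(2 * Real.pi) := by positivity
    have s4 : 0 < √(w : ℝ) := by positivity
    have c : (√(2 * Real.pi * v))⁻¹ ^ 2 =
        √w / v * (√(2 * Real.pi * w))⁻¹ * (√(2 * Real.pi))⁻¹ := by
      rw [inv_pow, s1, s]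
      field_simp
      rw [s2]
    rw [mul_pow, e, c]
    ring
  -- With `u = (v - 1)²` one has `k² = 1 / (1 - u)`; the bound `1 + 2 u` needs exactly `u ≤ 1/2`.
  -- The exponential form makes constants multiply well over coordinates.
  have hkexp : k ≤ Real.exp (((v : ℝ) - 1) ^ 2) := by
    refine le_of_sq_le_sq ?_ (Real.exp_pos _).le
    set u := ((v : ℝ) - 1) ^ 2 with hu
    have h1 : k ^ 2 = (1 - u)⁻¹ := by
      rw [hk, div_pow, Real.sq_sqrt hw0.le, hw, hu]
      have : 1 - ((v : ℝ) - 1) ^ 2 = v * (2 - v) := by ring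
      rw [this]
      field_simp
    have h2 : Real.exp u ^ 2 = Real.exp (2 * u) := by
      rw [← Real.exp_nat_mul]
      norm_num
    have hu0 : 0 ≤ u := sq_nonneg _
    have hu1 : 0 < 1 - u := by linarith
    rw [h1, h2]
    calc (1 - u)⁻¹ ≤ 2 * u + 1 := by
          rw [inv_le_iff_one_le_mul₀ hu1]
          nlinarith
      _ ≤ Real.exp (2 * u) := Real.add_one_le_exp _
  have hm := measurable_gaussianPDF
  have hpt : ∀ x, g x * gaussianPDF 0 v x =
      (g x * gaussianPDF 0 1 x ^ (1 / 2 : ℝ)) *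
        (ENNReal.ofReal k * gaussianPDF 0 w x) ^ (1 / 2 : ℝ) := by
    intro x
    rw [mul_assoc, ← ENNReal.mul_rpow_of_nonneg _ _ (by norm_num : (0 : ℝ) ≤ 1 / 2)]
    congr 1
    have : gaussianPDF 0 1 x * (ENNReal.ofReal k * gaussianPDF 0 w x) =
        gaussianPDF 0 v x ^ (2 : ℝ) := by
      have h2 : gaussianPDF 0 v x ^ (2 : ℝ) = gaussianPDF 0 v x ^ 2 := by
        exact_mod_cast ENNReal.rpow_natCast (gaussianPDF 0 v x) 2
      rw [h2]
      simp only [gaussianPDF_def]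
      rw [← ENNReal.ofReal_pow (gaussianPDFReal_nonneg _ _ _), key,
        ENNReal.ofReal_mul (mul_nonneg hk0 (gaussianPDFReal_nonneg _ _ _)),
        ENNReal.ofReal_mul hk0]
      ring
    rw [this, ← ENNReal.rpow_mul]
    norm_num
  have hsq : ∀ a : ℝ≥0∞, (a ^ (1 / 2 : ℝ)) ^ (2 : ℝ) = a := by
    intro a
    rw [← ENNReal.rpow_mul]
    norm_num
  have hsq' : ∀ a : ℝ≥0∞, (a ^ (1 / 2 : ℝ)) ^ 2 = a := by
    intro a
    rw [← ENNReal.rpow_natCast, ← ENNReal.rpow_mul]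
    norm_num
  have holder := ENNReal.lintegral_mul_le_Lp_mul_Lq volume Real.HolderConjugate.two_two
    (f := fun x => g x * gaussianPDF 0 1 x ^ (1 / 2 : ℝ))
    (g := fun x => (ENNReal.ofReal k * gaussianPDF 0 w x) ^ (1 / 2 : ℝ))
    (by fun_prop) (by fun_prop)
  simp only [Pi.mul_apply] at holder
  rw [gaussianReal_of_var_ne_zero 0 hvne, gaussianReal_of_var_ne_zero 0 one_ne_zero,
    lintegral_withDensity_eq_lintegral_mul _ (by fun_prop) hg,
    lintegral_withDensity_eq_lintegral_mul _ (by fun_prop) (by fun_prop)]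
  simp only [Pi.mul_apply]
  simp_rw [mul_comm (gaussianPDF 0 v _), hpt]
  calc _ ≤ _ := pow_le_pow_left₀ (zero_le) holder 2
    _ = (∫⁻ x, gaussianPDF 0 1 x * g x ^ 2) * ENNReal.ofReal k := by
      simp_rw [hsq, ENNReal.mul_rpow_of_nonneg _ _ (by norm_num : (0 : ℝ) ≤ 2), hsq]
      rw [mul_pow, hsq', hsq', lintegral_const_mul _ (by fun_prop),
        lintegral_gaussianPDF_eq_one _ hwne, mul_one]
      congr 1
      refine lintegral_congr fun x => ?_
      rw [mul_comm]
      congr 1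
      exact_mod_cast ENNReal.rpow_natCast (g x) 2
    _ ≤ _ := by
      rw [mul_comm]
      gcongr

open scoped ENNReal in
/-- Tensorization of an `L¹(ν)`–`L²(γ)` bound. -/
theorem sq_lintegral_pi_le {ι : Type*} [Fintype ι] {X : ι → Type*}
    [∀ i, MeasurableSpace (X i)] (ν γ : ∀ i, Measure (X i))
    [∀ i, SigmaFinite (ν i)] [∀ i, SigmaFinite (γ i)] (c : ι → ℝ≥0∞)
    (h : ∀ i, ∀ g : X i → ℝ≥0∞, Measurable g →
      (∫⁻ x, g x ∂ν i) ^ 2 ≤ c i * ∫⁻ x, g x ^ 2 ∂γ i)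
    (f : (∀ i, X i) → ℝ≥0∞) (hf : Measurable f) :
    (∫⁻ x, f x ∂Measure.pi ν) ^ 2 ≤ (∏ i, c i) * ∫⁻ x, f x ^ 2 ∂Measure.pi γ := by
  classical
  -- Integrating out one more coordinate applies `h i` to the marginal over `s`, whose square the
  -- induction hypothesis bounds pointwise.
  have main : ∀ s : Finset ι, ∀ x, ((∫⋯∫⁻_s, f ∂ν) x) ^ 2 ≤
      (∏ i ∈ s, c i) * (∫⋯∫⁻_s, (fun y => f y ^ 2) ∂γ) x := by
    intro s
    induction s using Finset.induction_on with
    | empty => simp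
    | insert i s hi ih =>
      intro x
      rw [lmarginal_insert _ hf hi, lmarginal_insert _ (hf.pow_const 2) hi,
        Finset.prod_insert hi]
      have hm : Measurable fun y => (∫⋯∫⁻_s, f ∂ν) (Function.update x i y) :=
        (hf.lmarginal ν).comp (measurable_update x)
      have hm' : Measurable fun y => (∫⋯∫⁻_s, (fun y => f y ^ 2) ∂γ) (Function.update x i y) :=
        ((hf.pow_const 2).lmarginal γ).comp (measurable_update x)
      refine (h i _ hm).trans ?_
      rw [mul_assoc, ← lintegral_const_mul _ hm']
      gcongr with y
      exact ih _
  by_cases hX : Nonempty (∀ i, X i)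
  · obtain ⟨x⟩ := hX
    rw [lintegral_eq_lmarginal_univ x, lintegral_eq_lmarginal_univ (f := fun y => f y ^ 2) x]
    exact main Finset.univ x
  · rw [not_nonempty_iff] at hX
    simp [lintegral_of_isEmpty]

/-- A centered Gaussian law in the eigenbasis of its covariance matrix. -/
theorem multivariateGaussian_eq_map_pi_eigenvectorBasis {ι : Type*} [Fintype ι] [DecidableEq ι]
    {S : Matrix ι ι ℝ} (hS : S.PosSemidef) :
    multivariateGaussian 0 S =
      (Measure.pi fun i => gaussianReal 0 (hS.1.eigenvalues i).toNNReal).map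
        (fun x => ∑ i, x i • hS.1.eigenvectorBasis i) := by
  -- Both characteristic functions are `exp (-½ ∑ λᵢ ⟨bᵢ, t⟩²)`; a zero eigenvalue just gives a
  -- Dirac factor.
  apply Measure.ext_of_charFun (E := EuclideanSpace ℝ ι)
  ext t
  rw [charFun_multivariateGaussian hS, charFun_apply,
    integral_map (Measurable.aemeasurable (by fun_prop))
    (Measurable.aestronglyMeasurable (by fun_prop))]
  set b := hS.1.eigenvectorBasis with hb
  set l := hS.1.eigenvalues with hl
  have hq : (t.ofLp ⬝ᵥ S.mulVec t.ofLp) = ∑ i, l i * inner ℝ (b i) t ^ 2 := by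
    have h1 : t.ofLp = ∑ i, inner ℝ (b i) t • (b i).ofLp := by
      conv_lhs => rw [← b.sum_repr' t]
      simp
    have h2 : S.mulVec t.ofLp = ∑ i, inner ℝ (b i) t • l i • (b i).ofLp := by
      conv_lhs => rw [h1]
      rw [Matrix.mulVec_sum]
      refine Finset.sum_congr rfl fun i _ => ?_
      rw [Matrix.mulVec_smul, hb, hS.1.mulVec_eigenvectorBasis]
    rw [h2, dotProduct_sum]
    refine Finset.sum_congr rfl fun i _ => ?_
    rw [dotProduct_smul, dotProduct_smul]
    have : t.ofLp ⬝ᵥ (b i).ofLp = inner ℝ (b i) t := by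
      simp [PiLp.inner_apply, dotProduct]
    rw [this]
    simp only [smul_eq_mul]
    ring
  simp_rw [sum_inner, Complex.ofReal_sum, Finset.sum_mul, Complex.exp_sum]
  rw [integral_fintype_prod_eq_prod
    (f := fun i x => Complex.exp (inner ℝ (x • b i) t * Complex.I))]
  simp_rw [real_inner_smul_left, mul_comm _ (inner ℝ _ _), Complex.ofReal_mul,
    ← charFun_apply_real, charFun_gaussianReal]
  have hl0 : ∀ i, 0 ≤ l i := hS.eigenvalues_nonneg
  rw [← Complex.exp_sum, hq]
  congr 1
  simp only [inner_zero_right, Complex.ofReal_zero, zero_mul, zero_sub, mul_zero,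
    Finset.sum_neg_distrib, Complex.ofReal_sum, Finset.sum_div]
  congr 1
  refine Finset.sum_congr rfl fun i _ => ?_
  rw [Real.coe_toNNReal _ (hl0 i)]
  push_cast
  ring

/-- The squared Frobenius distance to the identity, in terms of eigenvalues. -/
theorem sum_sq_eigenvalues_sub_one {ι : Type*} [Fintype ι] [DecidableEq ι]
    {S : Matrix ι ι ℝ} (hS : S.IsHermitian) :
    ∑ i, (hS.eigenvalues i - 1) ^ 2 = ∑ i, ∑ j, (S i j - (1 : Matrix ι ι ℝ) i j) ^ 2 := by
  set b := hS.eigenvectorBasis with hb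
  have h1 : ∀ v : EuclideanSpace ℝ ι, ‖v‖ ^ 2 = ∑ j, inner ℝ v (b j) ^ 2 := fun v =>
    (b.sum_sq_inner_left v).symm
  -- Row `i` of `S - 1` has coordinates `(λₖ - 1) bₖ(i)` in the eigenbasis; this is Parseval.
  have h2 : ∀ i, ∑ j, (S i j - (1 : Matrix ι ι ℝ) i j) ^ 2 =
      ∑ k, ((hS.eigenvalues k - 1) * b k i) ^ 2 := by
    intro i
    have := h1 (WithLp.toLp 2 fun j => S i j - (1 : Matrix ι ι ℝ) i j)
    rw [EuclideanSpace.real_norm_sq_eq] at this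
    simp only at this
    rw [this]
    refine Finset.sum_congr rfl fun k _ => ?_
    congr 1
    have h3 := congrFun (hS.mulVec_eigenvectorBasis k) i
    simp only [Matrix.mulVec, dotProduct, Pi.smul_apply, smul_eq_mul] at h3
    rw [PiLp.inner_apply, sub_mul, hb, ← h3]
    simp only [RCLike.inner_apply, conj_trivial, mul_sub, Finset.sum_sub_distrib]
    simp [Matrix.one_apply, mul_comm]
  simp_rw [h2]
  rw [Finset.sum_comm]
  refine Finset.sum_congr rfl fun k _ => ?_
  simp_rw [mul_pow]
  rw [← Finset.mul_sum, ← EuclideanSpace.real_norm_sq_eq, b.norm_eq_one]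
  simp

open scoped ENNReal in
/-- A Gaussian law whose covariance is close to the identity in Frobenius norm is dominated by
the square root of the standard Gaussian law, with a constant independent of the dimension. -/
theorem sq_multivariateGaussian_le {ι : Type*} [Fintype ι] [DecidableEq ι]
    {S : Matrix ι ι ℝ} (hS : S.PosSemidef)
    (h : ∑ i, ∑ j, (S i j - (1 : Matrix ι ι ℝ) i j) ^ 2 ≤ 1 / 2)
    {A : Set (EuclideanSpace ℝ ι)} (hA : MeasurableSet A) :
    multivariateGaussian 0 S A ^ 2 ≤ ENNReal.ofReal 2 * stdGaussian (EuclideanSpace ℝ ι) A := by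
  rw [← sum_sq_eigenvalues_sub_one hS.1] at h
  have hl : ∀ i, (((hS.1.eigenvalues i).toNNReal : ℝ) - 1) ^ 2 =
      (hS.1.eigenvalues i - 1) ^ 2 := fun i => by
    rw [Real.coe_toNNReal _ (hS.eigenvalues_nonneg i)]
  have hi : ∀ i, (((hS.1.eigenvalues i).toNNReal : ℝ) - 1) ^ 2 ≤ 1 / 2 := fun i => by
    rw [hl]
    exact (Finset.single_le_sum (f := fun i => (hS.1.eigenvalues i - 1) ^ 2)
      (fun i _ => sq_nonneg _) (Finset.mem_univ i)).trans h
  have hm : Measurable fun x : ι → ℝ => ∑ i, x i • hS.1.eigenvectorBasis i := by fun_prop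
  rw [multivariateGaussian_eq_map_pi_eigenvectorBasis hS,
    stdGaussian_eq_map_pi_orthonormalBasis hS.1.eigenvectorBasis,
    Measure.map_apply hm hA, Measure.map_apply hm hA]
  set B := (fun x : ι → ℝ => ∑ i, x i • hS.1.eigenvectorBasis i) ⁻¹' A
  have hB : MeasurableSet B := hm hA
  have := sq_lintegral_pi_le (fun i => gaussianReal 0 (hS.1.eigenvalues i).toNNReal)
    (fun _ => gaussianReal 0 1) _
    (fun i g hg => sq_lintegral_gaussianReal_le _ (hi i) g hg)
    (B.indicator 1) (measurable_one.indicator hB)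
  -- An indicator is its own square, so the `L¹`–`L²` bound compares measures of `B`.
  have hind : ∀ x, B.indicator (1 : (ι → ℝ) → ℝ≥0∞) x ^ 2 = B.indicator 1 x := fun x => by
    by_cases hx : x ∈ B <;> simp [hx]
  simp_rw [hind] at this
  rw [lintegral_indicator_one hB, lintegral_indicator_one hB] at this
  refine this.trans ?_
  gcongr
  rw [← ENNReal.ofReal_prod_of_nonneg fun i _ => (Real.exp_pos _).le, ← Real.exp_sum]
  apply ENNReal.ofReal_le_ofReal
  simp_rw [hl]
  calc Real.exp (∑ i, (hS.1.eigenvalues i - 1) ^ 2) ≤ Real.exp (1 / 2) := Real.exp_le_exp.2 h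
    _ ≤ 2 := by
      refine le_of_sq_le_sq ?_ (by norm_num)
      rw [← Real.exp_nat_mul]
      have := Real.exp_one_lt_d9
      norm_num
      linarith

/-! ### Moments of sums of independent variables. -/

theorem integrable_pow_of_memLp_six {Ω : Type*} [MeasurableSpace Ω] {P : Measure Ω}
    [IsProbabilityMeasure P] {X : Ω → ℝ} (hX : MemLp X 6 P) {k : ℕ} (hk : k ≤ 6) :
    Integrable (fun ω => X ω ^ k) P := by
  have h : MemLp X k P := hX.mono_exponent (by exact_mod_cast hk)
  have := h.integrable_norm_pow'
  refine this.mono (hX.1.pow k) (ae_of_all _ fun ω => ?_)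
  simp

theorem integral_add_pow_of_indepFun {Ω : Type*} [MeasurableSpace Ω] {P : Measure Ω}
    [IsProbabilityMeasure P] {X Y : Ω → ℝ} (hX : MemLp X 6 P) (hY : MemLp Y 6 P)
    (h : IndepFun X Y P) (k : ℕ) (hk : k ≤ 6) :
    ∫ ω, (X ω + Y ω) ^ k ∂P = ∑ m ∈ Finset.range (k + 1),
      (∫ ω, X ω ^ m ∂P) * (∫ ω, Y ω ^ (k - m) ∂P) * k.choose m := by
  have hi : ∀ m ≤ k, IndepFun (fun ω => X ω ^ m) (fun ω => Y ω ^ (k - m)) P := fun m _ =>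
    h.comp (φ := fun x => x ^ m) (ψ := fun x => x ^ (k - m)) (by fun_prop) (by fun_prop)
  simp_rw [add_pow]
  rw [integral_finsetSum]
  · refine Finset.sum_congr rfl fun m hm => ?_
    have hm' : m ≤ k := by
      rw [Finset.mem_range] at hm
      omega
    rw [integral_mul_const, (hi m hm').integral_fun_mul_eq_mul_integral
      (hX.1.pow m) (hY.1.pow (k - m))]
  · intro m hm
    have hm' : m ≤ k := by
      rw [Finset.mem_range] at hm
      omega
    exact ((hi m hm').integrable_mul (integrable_pow_of_memLp_six hX (by omega))
      (integrable_pow_of_memLp_six hY (by omega))).mul_const _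

/-- Even moments up to order six of a sum of independent centered variables. -/
theorem moments_sum_of_iIndepFun {Ω ι : Type*} [MeasurableSpace Ω] {P : Measure Ω}
    [IsProbabilityMeasure P] {Y : ι → Ω → ℝ} (hY : ∀ i, MemLp (Y i) 6 P)
    (hm : ∀ i, Measurable (Y i))
    (hind : iIndepFun Y P) (h0 : ∀ i, ∫ ω, Y i ω ∂P = 0) (c : ι → ℝ)
    (hc : ∀ i, 1 + ∫ ω, Y i ω ^ 6 ∂P ≤ c i) (s : Finset ι) :
    ∫ ω, (∑ i ∈ s, Y i ω) ∂P = 0 ∧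
    ∫ ω, (∑ i ∈ s, Y i ω) ^ 2 ∂P ≤ ∑ i ∈ s, c i ∧
    ∫ ω, (∑ i ∈ s, Y i ω) ^ 4 ∂P ≤ 4 * (∑ i ∈ s, c i) ^ 2 ∧
    ∫ ω, (∑ i ∈ s, Y i ω) ^ 6 ∂P ≤ 40 * (∑ i ∈ s, c i) ^ 3 := by
  classical
  have hc1 : ∀ i, 1 ≤ c i := fun i =>
    (le_add_of_nonneg_right (integral_nonneg fun ω => by positivity)).trans (hc i)
  induction s using Finset.induction_on with
  | empty => simp
  | insert a s ha ih =>
    obtain ⟨i1, i2, i4, i6⟩ := ih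
    set T := ∑ i ∈ s, c i with hT
    have hT0 : 0 ≤ T := Finset.sum_nonneg fun i _ => zero_le_one.trans (hc1 i)
    set X : Ω → ℝ := fun ω => ∑ i ∈ s, Y i ω with hXdef
    have hX : MemLp X 6 P := memLp_finsetSum s fun i _ => hY i
    have hXY : IndepFun X (Y a) P := by
      have := hind.indepFun_finsetSum_of_notMem hm ha
      convert this using 1
      ext ω
      simp [hXdef]
    have iX : ∀ k ≤ 6, Integrable (fun ω => X ω ^ k) P := fun k hk =>
      integrable_pow_of_memLp_six hX hk
    have iY : ∀ k ≤ 6, Integrable (fun ω => Y a ω ^ k) P := fun k hk =>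
      integrable_pow_of_memLp_six (hY a) hk
    -- From `|y|^k ≤ 1 + y⁶`: a single constant controls all moments up to order six.
    have hYk : ∀ k ≤ 6, |∫ ω, Y a ω ^ k ∂P| ≤ c a := by
      intro k hk
      refine abs_integral_le_integral_abs.trans (le_trans ?_ (hc a))
      have : (1 : ℝ) = ∫ _, (1 : ℝ) ∂P := by simp
      conv_rhs => rw [this]
      rw [← integral_add (integrable_const _) (iY 6 le_rfl)]
      refine integral_mono (iY k hk).abs ((integrable_const _).add (iY 6 le_rfl)) fun ω => ?_
      have h6 : Y a ω ^ 6 = |Y a ω| ^ 6 := by rw [Even.pow_abs (by decide)]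
      simp only [abs_pow]
      rw [h6]
      rcases le_total |Y a ω| 1 with h | h
      · have := pow_le_one₀ (n := k) (abs_nonneg (Y a ω)) h
        have := pow_nonneg (abs_nonneg (Y a ω)) 6
        linarith
      · have := pow_le_pow_right₀ h hk
        linarith
    -- The induction carries no third moment; it is recovered from `|x|³ ≤ (x² + x⁴) / 2`.
    have hX3 : |∫ ω, X ω ^ 3 ∂P| ≤ (T + 4 * T ^ 2) / 2 := by
      refine abs_integral_le_integral_abs.trans ?_
      calc ∫ ω, |X ω ^ 3| ∂P ≤ ∫ ω, (X ω ^ 2 + X ω ^ 4) / 2 ∂P := by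
            refine integral_mono (iX 3 (by norm_num)).abs
              (((iX 2 (by norm_num)).add (iX 4 (by norm_num))).div_const 2) fun ω => ?_
            have h2 : X ω ^ 2 = |X ω| ^ 2 := by rw [sq_abs]
            have h4 : X ω ^ 4 = |X ω| ^ 4 := by rw [Even.pow_abs (by decide)]
            simp only [abs_pow]
            rw [h2, h4]
            nlinarith [sq_nonneg (|X ω| * (|X ω| - 1))]
        _ = (∫ ω, X ω ^ 2 ∂P + ∫ ω, X ω ^ 4 ∂P) / 2 := by
            rw [integral_div, integral_add (iX 2 (by norm_num)) (iX 4 (by norm_num))]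
        _ ≤ _ := by linarith
    have hs : ∀ ω, ∑ i ∈ insert a s, Y i ω = X ω + Y a ω := fun ω => by
      rw [Finset.sum_insert ha, add_comm]
    have hcs : ∑ i ∈ insert a s, c i = T + c a := by
      rw [Finset.sum_insert ha, add_comm]
    have a1 := hc1 a
    have e1 : ∫ ω, X ω ∂P = 0 := i1
    have y2 := (abs_le.1 (hYk 2 (by norm_num))).2
    have y4 := (abs_le.1 (hYk 4 (by norm_num))).2
    have y6 := (abs_le.1 (hYk 6 (by norm_num))).2
    have p2 : 0 ≤ ∫ ω, Y a ω ^ 2 ∂P := integral_nonneg fun ω => by positivity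
    have p4 : 0 ≤ ∫ ω, Y a ω ^ 4 ∂P := integral_nonneg fun ω => by positivity
    have q2 : (∫ ω, X ω ^ 2 ∂P) * (∫ ω, Y a ω ^ 2 ∂P) ≤ T * c a :=
      mul_le_mul i2 y2 p2 hT0
    have q24 : (∫ ω, X ω ^ 2 ∂P) * (∫ ω, Y a ω ^ 4 ∂P) ≤ T * c a :=
      mul_le_mul i2 y4 p4 hT0
    have q42 : (∫ ω, X ω ^ 4 ∂P) * (∫ ω, Y a ω ^ 2 ∂P) ≤ 4 * T ^ 2 * c a :=
      mul_le_mul i4 y2 p2 (by positivity)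
    have q33 : (∫ ω, X ω ^ 3 ∂P) * (∫ ω, Y a ω ^ 3 ∂P) ≤ (T + 4 * T ^ 2) / 2 * c a := by
      refine (le_abs_self _).trans ?_
      rw [abs_mul]
      exact mul_le_mul hX3 (hYk 3 (by norm_num)) (abs_nonneg _) (by positivity)
    have f2 := integral_add_pow_of_indepFun hX (hY a) hXY 2 (by norm_num)
    have f4 := integral_add_pow_of_indepFun hX (hY a) hXY 4 (by norm_num)
    have f6 := integral_add_pow_of_indepFun hX (hY a) hXY 6 (by norm_num)
    simp [Finset.sum_range_succ, e1, h0 a, Nat.choose] at f2 f4 f6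
    simp_rw [hs, hcs]
    refine ⟨?_, ?_, ?_, ?_⟩
    · rw [integral_add (hX.integrable (by norm_num)) ((hY a).integrable (by norm_num)), e1, h0 a]
      simp
    · rw [f2]
      linarith
    · rw [f4]
      nlinarith [mul_nonneg hT0 (zero_le_one.trans a1)]
    -- Terms with a first power vanish, leaving at most `40 T³ + 100 T² c + 25 T c + c`, which `c ≥
    -- 1` puts below `40 (T + c)³`.
    · rw [f6]
      have t1 : 0 ≤ T * c a := mul_nonneg hT0 (by linarith)
      have t2 : T * c a ≤ T * c a ^ 2 := by nlinarith
      have t3 : 0 ≤ T ^ 2 * c a := by positivity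
      have t4 : c a ≤ c a ^ 3 := le_self_pow₀ a1 (by norm_num)
      nlinarith

/-! ### Splitting into weakly correlated blocks. -/

/-- The points of a finite set can be coloured with `K` colours so that at most the fraction
`1 / K` of the total weight lies on monochromatic pairs. -/
theorem exists_coloring_sum_le {ι : Type*} [DecidableEq ι] (w : ι → ι → ℝ)
    (hdiag : ∀ i, w i i = 0) (K : ℕ) (hK : 0 < K) (s : Finset ι) :
    ∃ f : ι → Fin K, K * ∑ i ∈ s, ∑ j ∈ s, (if f i = f j then w i j else 0) ≤
      ∑ i ∈ s, ∑ j ∈ s, w i j := by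
  induction s using Finset.induction_on with
  | empty => exact ⟨fun _ => ⟨0, hK⟩, by simp⟩
  | insert a s ha ih =>
    obtain ⟨f, hf⟩ := ih
    -- Greedy choice: the weights joining `a` to the colour classes add up to its total weight to
    -- `s`, so some class carries at most the average.
    obtain ⟨k, hk⟩ : ∃ k : Fin K,
        K * ∑ j ∈ s, (if f j = k then w a j + w j a else 0) ≤ ∑ j ∈ s, (w a j + w j a) := by
      have : Nonempty (Fin K) := ⟨⟨0, hK⟩⟩
      by_contra! h
      have h1 := Finset.sum_lt_sum_of_nonempty (s := (Finset.univ : Finset (Fin K)))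
        Finset.univ_nonempty (fun k _ => h k)
      have h2 : ∑ k : Fin K, ∑ j ∈ s, (if f j = k then w a j + w j a else 0) =
          ∑ j ∈ s, (w a j + w j a) := by
        rw [Finset.sum_comm]
        simp
      rw [← Finset.mul_sum, h2, Finset.sum_const, Finset.card_univ, Fintype.card_fin,
        nsmul_eq_mul] at h1
      exact lt_irrefl _ h1
    refine ⟨Function.update f a k, ?_⟩
    have hne : ∀ i ∈ s, Function.update f a k i = f i := fun i hi =>
      Function.update_of_ne (ne_of_mem_of_not_mem hi ha) _ _
    have e1 : ∑ i ∈ insert a s, ∑ j ∈ insert a s,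
        (if Function.update f a k i = Function.update f a k j then w i j else 0) =
        ∑ j ∈ s, (if f j = k then w a j + w j a else 0) +
          ∑ i ∈ s, ∑ j ∈ s, (if f i = f j then w i j else 0) := by
      have h1 : ∀ i ∈ s, ∑ j ∈ insert a s,
          (if Function.update f a k i = Function.update f a k j then w i j else 0) =
          (if f i = k then w i a else 0) + ∑ j ∈ s, (if f i = f j then w i j else 0) := by
        intro i hi
        rw [Finset.sum_insert ha, hne i hi, Function.update_self]
        congr 1
        exact Finset.sum_congr rfl fun j hj => by rw [hne j hj]
      have h2 : ∑ j ∈ insert a s,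
          (if Function.update f a k a = Function.update f a k j then w a j else 0) =
          ∑ j ∈ s, (if f j = k then w a j else 0) := by
        rw [Finset.sum_insert ha, Function.update_self, hdiag]
        simp only [if_true, zero_add]
        exact Finset.sum_congr rfl fun j hj => by rw [hne j hj]; simp only [eq_comm]
      rw [Finset.sum_insert ha, Finset.sum_congr rfl h1, h2, Finset.sum_add_distrib, ← add_assoc,
        ← Finset.sum_add_distrib]
      congr 1
      refine Finset.sum_congr rfl fun j _ => ?_
      split_ifs <;> simp
    have e2 : ∑ i ∈ insert a s, ∑ j ∈ insert a s, w i j =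
        ∑ j ∈ s, (w a j + w j a) + ∑ i ∈ s, ∑ j ∈ s, w i j := by
      rw [Finset.sum_insert ha, Finset.sum_insert ha, hdiag, zero_add,
        Finset.sum_congr rfl fun i _ => Finset.sum_insert ha, Finset.sum_add_distrib,
        Finset.sum_add_distrib]
      ring
    rw [e1, e2, mul_add]
    exact add_le_add hk hf

/-! ### Tail bounds, from independent coordinates to correlated ones. -/

open scoped ENNReal in
/-- A sixth moment tail bound for sums of independent functions of the coordinates. -/
theorem pi_abs_sum_ge_le {ι : Type*} [Fintype ι] (γ : ι → Measure ℝ)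
    [∀ i, IsProbabilityMeasure (γ i)] (ψ : ι → ℝ → ℝ) (hψ : ∀ i, Measurable (ψ i))
    (h6 : ∀ i, MemLp (ψ i) 6 (γ i)) (h0 : ∀ i, ∫ x, ψ i x ∂γ i = 0) (c : ι → ℝ)
    (hc : ∀ i, 1 + ∫ x, ψ i x ^ 6 ∂γ i ≤ c i) {t : ℝ} (ht : 0 < t) :
    Measure.pi γ {x | t ≤ |∑ i, ψ i (x i)|} ≤
      ENNReal.ofReal (40 * (∑ i, c i) ^ 3 / t ^ 6) := by
  have hp := fun i => measurePreserving_eval γ i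
  have hmom := (moments_sum_of_iIndepFun (P := Measure.pi γ) (Y := fun i x => ψ i (x i))
    (fun i => (h6 i).comp_measurePreserving (hp i))
    (fun i => (hψ i).comp (measurable_pi_apply i))
    (iIndepFun_pi fun i => (hψ i).aemeasurable)
    (fun i => by
      rw [← h0 i, ← (hp i).map_eq, integral_map (hp i).measurable.aemeasurable
        (hψ i).aestronglyMeasurable]) c
    (fun i => by
      refine le_trans (le_of_eq ?_) (hc i)
      rw [← (hp i).map_eq, integral_map (hp i).measurable.aemeasurable
        ((hψ i).pow_const 6).aestronglyMeasurable]) Finset.univ).2.2.2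
  have hint : Integrable (fun x : ι → ℝ => (∑ i, ψ i (x i)) ^ 6) (Measure.pi γ) :=
    integrable_pow_of_memLp_six
      (memLp_finsetSum _ fun i _ => (h6 i).comp_measurePreserving (hp i)) le_rfl
  have markov := mul_meas_ge_le_integral_of_nonneg
    (ae_of_all _ fun x : ι → ℝ => (by positivity : 0 ≤ (∑ i, ψ i (x i)) ^ 6)) hint (t ^ 6)
  have hset : {x : ι → ℝ | t ≤ |∑ i, ψ i (x i)|} ⊆ {x | t ^ 6 ≤ (∑ i, ψ i (x i)) ^ 6} := by
    intro x hx
    have := pow_le_pow_left₀ ht.le hx 6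
    rwa [Even.pow_abs (by decide)] at this
  rw [← ofReal_measureReal]
  apply ENNReal.ofReal_le_ofReal
  rw [le_div_iff₀ (by positivity), mul_comm]
  exact (mul_le_mul_of_nonneg_left (measureReal_mono hset) (by positivity)).trans
    (markov.trans hmom)

/-- Selecting and rescaling coordinates of a centered Gaussian vector. -/
theorem multivariateGaussian_map_mul_comp {ι κ : Type*} [Fintype ι] [DecidableEq ι] [Fintype κ]
    [DecidableEq κ] {S : Matrix ι ι ℝ} (hS : S.PosSemidef) (e : κ → ι) (c : κ → ℝ)
    (hC : (Matrix.of fun i j => c i * c j * S (e i) (e j)).PosSemidef) :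
    (multivariateGaussian 0 S).map (fun x => WithLp.toLp 2 fun j => c j * x (e j)) =
      multivariateGaussian 0 (Matrix.of fun i j => c i * c j * S (e i) (e j)) := by
  let L : EuclideanSpace ℝ ι →L[ℝ] EuclideanSpace ℝ κ := LinearMap.toContinuousLinearMap
    { toFun := fun x => WithLp.toLp 2 fun j => c j * x (e j)
      map_add' := fun x y => by
        ext j
        simp [mul_add]
      map_smul' := fun a x => by
        ext j
        simp [mul_left_comm] }
  change (multivariateGaussian 0 S).map L = _
  apply IsGaussian.ext
  · simp only [id_eq, integral_id_multivariateGaussian]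
    rw [ContinuousLinearMap.integral_id_map, integral_id_multivariateGaussian, map_zero]
    exact IsGaussian.integrable_id
  rw [← ContinuousLinearMap.toBilinForm_inj]
  refine LinearMap.BilinForm.ext_basis (EuclideanSpace.basisFun κ ℝ).toBasis fun i j ↦ ?_
  rw [ContinuousLinearMap.toBilinForm_apply, ContinuousLinearMap.toBilinForm_apply,
    covarianceBilin_apply_eq_cov, covariance_map]
  · have (i : κ) : (fun u ↦ inner ℝ ((EuclideanSpace.basisFun κ ℝ).toBasis i) u) ∘
        L = fun u ↦ c i * u (e i) := by
      ext u
      simp [PiLp.inner_apply, L]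
    simp_rw [this, covariance_const_mul_left, covariance_const_mul_right,
      covariance_eval_multivariateGaussian hS, covarianceBilin_multivariateGaussian hC]
    simp [mul_assoc]
  any_goals exact Measurable.aestronglyMeasurable (by fun_prop)
  · fun_prop
  · exact IsGaussian.memLp_two_id

open scoped ENNReal in
/-- Tail bound for a sum over a weakly correlated block of coordinates. -/
theorem multivariateGaussian_block_tail {ι : Type*} [Fintype ι] [DecidableEq ι]
    {S : Matrix ι ι ℝ} (hS : S.PosSemidef) (hdiag : ∀ i, S i i ≠ 0) (s : Finset ι)
    (hs : ∑ i ∈ s, ∑ j ∈ s, (if i = j then 0 else S i j ^ 2 / (S i i * S j j)) ≤ 1 / 2)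
    (ψ : ι → ℝ → ℝ) (hψ : ∀ i, Measurable (ψ i))
    (h6 : ∀ i, MemLp (ψ i) 6 (gaussianReal 0 (S i i).toNNReal))
    (h0 : ∀ i, ∫ x, ψ i x ∂gaussianReal 0 (S i i).toNNReal = 0) (c : ι → ℝ)
    (hc : ∀ i, 1 + ∫ x, ψ i x ^ 6 ∂gaussianReal 0 (S i i).toNNReal ≤ c i)
    {t : ℝ} (ht : 0 < t) :
    (multivariateGaussian 0 S).real {x | t ≤ |∑ i ∈ s, ψ i (x i)|} ≤
      √(80 * (∑ i ∈ s, c i) ^ 3 / t ^ 6) := by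
  have hpos : ∀ i, 0 < S i i := fun i => lt_of_le_of_ne hS.diag_nonneg (hdiag i).symm
  have hsq : ∀ i, √(S i i) * √(S i i) = S i i := fun i => Real.mul_self_sqrt (hpos i).le
  have hsq0 : ∀ i, 0 < √(S i i) := fun i => Real.sqrt_pos.2 (hpos i)
  -- The correlation matrix of the block: its diagonal is `1`, so its squared distance to the
  -- identity is the off-diagonal sum in `hs`.
  set C : Matrix s s ℝ := Matrix.of fun i j =>
    (√(S i i))⁻¹ * (√(S j j))⁻¹ * S i j with hCdef
  have hC : C.PosSemidef := by
    have := (hS.submatrix (fun i : s => (i : ι))).conjTranspose_mul_mul_same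
      (Matrix.diagonal fun i : s => (√(S i i))⁻¹)
    convert this using 1
    ext i j
    simp [hCdef]
    ring
  have hCdist : ∑ i, ∑ j, (C i j - (1 : Matrix s s ℝ) i j) ^ 2 ≤ 1 / 2 := by
    refine le_trans (le_of_eq ?_) hs
    rw [← Finset.sum_coe_sort s]
    refine Finset.sum_congr rfl fun i _ => ?_
    rw [← Finset.sum_coe_sort s]
    refine Finset.sum_congr rfl fun j _ => ?_
    by_cases hij : i = j
    · subst hij
      have := hsq i
      have := hsq0 i
      have : C i i = 1 := by
        simp only [hCdef, Matrix.of_apply]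
        field_simp
        rw [sq, hsq]
      simp [this]
    · have hij' : (i : ι) ≠ j := fun h => hij (Subtype.ext h)
      rw [if_neg hij', Matrix.one_apply_ne hij, sub_zero]
      simp only [hCdef, Matrix.of_apply, mul_pow, inv_pow, Real.sq_sqrt (hpos _).le]
      have := hpos i
      have := hpos j
      field_simp
  have hscale : ∀ i, (gaussianReal 0 1).map (fun x => √(S i i) * x) =
      gaussianReal 0 (S i i).toNNReal := by
    intro i
    rw [gaussianReal_map_const_mul]
    congr 1
    · simp
    · ext
      simp [Real.sq_sqrt (hpos i).le, (hpos i).le]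
  have hms : ∀ i, Measurable fun x : ℝ => √(S i i) * x := fun i => by fun_prop
  have hstd : stdGaussian (EuclideanSpace ℝ s)
      {y | t ≤ |∑ i : s, ψ i (√(S i i) * y i)|} ≤
      ENNReal.ofReal (40 * (∑ i ∈ s, c i) ^ 3 / t ^ 6) := by
    rw [← map_pi_eq_stdGaussian, Measure.map_apply (by fun_prop)
      (measurableSet_le measurable_const (by fun_prop)), ← Finset.sum_coe_sort s]
    refine pi_abs_sum_ge_le (fun _ : s => gaussianReal 0 1) (fun i x => ψ i (√(S i i) * x))
      (fun i => by fun_prop) (fun i => ?_) (fun i => ?_) (fun i => c i) (fun i => ?_) ht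
    · have := h6 i
      rw [← hscale] at this
      exact this.comp_of_map (hms _).aemeasurable
    · refine Eq.trans ?_ (h0 i)
      rw [← hscale, integral_map (hms _).aemeasurable (hψ i).aestronglyMeasurable]
    · refine le_trans (le_of_eq ?_) (hc i)
      rw [← hscale, integral_map (hms _).aemeasurable
        ((hψ i).pow_const 6).aestronglyMeasurable]
  have hmap := multivariateGaussian_map_mul_comp hS (fun i : s => (i : ι))
    (fun i => (√(S i i))⁻¹) hC
  have hmeas : MeasurableSet
      {y : EuclideanSpace ℝ s | t ≤ |∑ i : s, ψ i (√(S i i) * y i)|} :=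
    measurableSet_le measurable_const (by fun_prop)
  have hcmp := sq_multivariateGaussian_le hC hCdist hmeas
  rw [hCdef, ← hmap, Measure.map_apply (by fun_prop) hmeas] at hcmp
  have hpre : (fun x : EuclideanSpace ℝ ι => WithLp.toLp 2 fun j : s => (√(S j j))⁻¹ * x j) ⁻¹'
      {y : EuclideanSpace ℝ s | t ≤ |∑ i : s, ψ i (√(S i i) * y i)|} =
      {x | t ≤ |∑ i ∈ s, ψ i (x i)|} := by
    ext x
    simp only [Set.mem_preimage, Set.mem_ofPred_eq]
    rw [← Finset.sum_coe_sort s]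
    simp_rw [mul_inv_cancel_left₀ (hsq0 _).ne']
  rw [hpre] at hcmp
  -- The comparison bounds the squared probability, whence the root; `80` is `2 * 40`.
  refine Real.le_sqrt_of_sq_le ?_
  have hc0 : 0 ≤ ∑ i ∈ s, c i := Finset.sum_nonneg fun i _ =>
    le_trans (add_nonneg zero_le_one (integral_nonneg fun x => by positivity)) (hc i)
  have h := hcmp.trans (mul_le_mul_right hstd _)
  rw [← ENNReal.ofReal_mul (by norm_num)] at h
  have h' := ENNReal.toReal_mono ENNReal.ofReal_ne_top h
  rw [ENNReal.toReal_pow, ENNReal.toReal_ofReal (by positivity)] at h'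
  refine h'.trans (le_of_eq ?_)
  ring

/-- Tail bound for a sum of functions of the coordinates of a Gaussian vector whose correlations
have a bounded sum of squares. -/
theorem multivariateGaussian_sum_tail {ι : Type*} [Fintype ι] [DecidableEq ι]
    {S : Matrix ι ι ℝ} (hS : S.PosSemidef) (hdiag : ∀ i, S i i ≠ 0) (K : ℕ) (hK : 0 < K)
    (hR : ∑ i, ∑ j, (if i = j then 0 else S i j ^ 2 / (S i i * S j j)) ≤ K / 2)
    (ψ : ι → ℝ → ℝ) (hψ : ∀ i, Measurable (ψ i))
    (h6 : ∀ i, MemLp (ψ i) 6 (gaussianReal 0 (S i i).toNNReal))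
    (h0 : ∀ i, ∫ x, ψ i x ∂gaussianReal 0 (S i i).toNNReal = 0) (c : ι → ℝ)
    (hc : ∀ i, 1 + ∫ x, ψ i x ^ 6 ∂gaussianReal 0 (S i i).toNNReal ≤ c i)
    {t : ℝ} (ht : 0 < t) :
    (multivariateGaussian 0 S).real {x | t ≤ |∑ i, ψ i (x i)|} ≤
      K * √(80 * (∑ i, c i) ^ 3 / (t / K) ^ 6) := by
  have hK' : (0 : ℝ) < K := by exact_mod_cast hK
  have hpos : ∀ i, 0 ≤ S i i := fun i => hS.diag_nonneg
  have hc0 : ∀ i, 0 ≤ c i := fun i =>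
    le_trans (add_nonneg zero_le_one (integral_nonneg fun x => by positivity)) (hc i)
  set w : ι → ι → ℝ := fun i j => if i = j then 0 else S i j ^ 2 / (S i i * S j j) with hw
  have hw0 : ∀ i j, 0 ≤ w i j := fun i j => by
    have := hpos i
    have := hpos j
    simp only [hw]
    split_ifs <;> positivity
  obtain ⟨f, hf⟩ := exists_coloring_sum_le w (fun i => by simp [hw]) K hK Finset.univ
  -- Weights are nonnegative, so each block carries at most the whole monochromatic weight, which is
  -- at most `(K / 2) / K`.
  have hblock : ∀ k : Fin K, ∑ i ∈ Finset.univ.filter (f · = k),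
      ∑ j ∈ Finset.univ.filter (f · = k), w i j ≤ 1 / 2 := by
    intro k
    have h1 : ∑ i, ∑ j, (if f i = f j then w i j else 0) ≤ 1 / 2 := by
      have := hf.trans hR
      rw [div_eq_mul_one_div] at this
      exact le_of_mul_le_mul_left this hK'
    refine le_trans ?_ h1
    rw [Finset.sum_filter]
    refine Finset.sum_le_sum fun i _ => ?_
    split_ifs with hi
    · rw [Finset.sum_filter]
      refine le_of_eq (Finset.sum_congr rfl fun j _ => ?_)
      simp only [hi, eq_comm]
    · exact Finset.sum_nonneg fun j _ => by split_ifs <;> simp [hw0]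
  have hsub : {x : EuclideanSpace ℝ ι | t ≤ |∑ i, ψ i (x i)|} ⊆
      ⋃ k : Fin K, {x | t / K ≤ |∑ i ∈ Finset.univ.filter (f · = k), ψ i (x i)|} := by
    intro x hx
    by_contra hn
    simp only [Set.mem_iUnion, Set.mem_ofPred_eq, not_exists, not_le] at hn
    have : Nonempty (Fin K) := ⟨⟨0, hK⟩⟩
    have h1 := Finset.sum_lt_sum_of_nonempty (s := (Finset.univ : Finset (Fin K)))
      Finset.univ_nonempty (fun k _ => hn k)
    rw [Finset.sum_const, Finset.card_univ, Fintype.card_fin, nsmul_eq_mul,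
      mul_div_cancel₀ _ hK'.ne'] at h1
    have h2 := Finset.abs_sum_le_sum_abs
      (fun k : Fin K => ∑ i ∈ Finset.univ.filter (f · = k), ψ i (x i)) Finset.univ
    rw [Finset.sum_fiberwise] at h2
    exact absurd hx (not_le.2 (h2.trans_lt h1))
  calc _ ≤ _ := measureReal_mono hsub
    _ ≤ ∑ k : Fin K, _ := measureReal_iUnion_fintype_le _
    _ ≤ ∑ k : Fin K, √(80 * (∑ i, c i) ^ 3 / (t / K) ^ 6) := by
      refine Finset.sum_le_sum fun k _ => ?_
      refine (multivariateGaussian_block_tail hS hdiag _ (hblock k) ψ hψ h6 h0 c hc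
        (div_pos ht hK')).trans ?_
      have : 0 ≤ ∑ i ∈ Finset.univ.filter (f · = k), c i := Finset.sum_nonneg fun i _ => hc0 i
      have : ∑ i ∈ Finset.univ.filter (f · = k), c i ≤ ∑ i, c i :=
        Finset.sum_le_univ_sum_of_nonneg hc0
      gcongr
    _ = _ := by simp

/-! ### Borel–Cantelli and the conclusion. -/

/-- Borel–Cantelli criterion for almost sure convergence to zero. -/
theorem ae_tendsto_zero_of_summable_tail {Ω : Type*} [MeasurableSpace Ω] {P : Measure Ω}
    [IsFiniteMeasure P] {Z : ℕ → Ω → ℝ}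
    (h : ∀ ε > 0, ∃ b : ℕ → ℝ, Summable b ∧ ∀ n, 1 ≤ n → P.real {ω | ε ≤ |Z n ω|} ≤ b n) :
    ∀ᵐ ω ∂P, Tendsto (fun n => Z n ω) atTop (𝓝 0) := by
  have key : ∀ k : ℕ, ∀ᵐ ω ∂P, ∀ᶠ n in atTop, |Z n ω| < 1 / ((k : ℝ) + 1) := by
    intro k
    obtain ⟨b, hb, hbn⟩ := h (1 / ((k : ℝ) + 1)) (by positivity)
    have hsum : ∑' n, P {ω | 1 / ((k : ℝ) + 1) ≤ |Z (n + 1) ω|} ≠ ⊤ := by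
      have hb' := (summable_nat_add_iff 1).2 hb
      refine ne_top_of_le_ne_top hb'.tsum_ofReal_ne_top (ENNReal.tsum_le_tsum fun n => ?_)
      rw [← ofReal_measureReal]
      exact ENNReal.ofReal_le_ofReal (hbn (n + 1) (by omega))
    filter_upwards [ae_eventually_notMem hsum] with ω hω
    obtain ⟨N, hN⟩ := eventually_atTop.1 hω
    filter_upwards [eventually_ge_atTop (N + 1)] with n hn
    obtain ⟨m, rfl⟩ : ∃ m, n = m + 1 := ⟨n - 1, by omega⟩
    simpa using hN m (by omega)
  filter_upwards [ae_all_iff.2 key] with ω hω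
  rw [Metric.tendsto_atTop']
  intro ε hε
  obtain ⟨k, hk⟩ := exists_nat_one_div_lt hε
  obtain ⟨N, hN⟩ := eventually_atTop.1 (hω k)
  exact ⟨N, fun n hn => by
    rw [Real.dist_eq, sub_zero]
    exact (hN n hn.le).trans hk⟩

open scoped ENNReal in
/-- Tail bound for a centered sum of measurable functions of the coordinates of a Gaussian vector,
in terms of absolute moments of order at least six. -/
theorem sum_tail_of_hasLaw_multivariateGaussian {Ω : Type*} [MeasurableSpace Ω] {P : Measure Ω}
    [IsProbabilityMeasure P] {n : ℕ} {Z : Ω → EuclideanSpace ℝ (Fin n)}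
    {S : Matrix (Fin n) (Fin n) ℝ} (hS : S.PosSemidef) (hdiag : ∀ i, S i i ≠ 0)
    (hZ : HasLaw Z (multivariateGaussian 0 S) P) {R : ℝ}
    (hcorr : ∑ i, ∑ j ∈ Finset.Ioi i, S i j ^ 2 / (S i i * S j j) ≤ R)
    {φ : Fin n → ℝ → ℝ} (hφ : ∀ i, AEMeasurable (φ i) volume)
    (hint : ∀ i, Integrable (fun ω => φ i (Z ω i)) P) {μ : Fin n → ℝ}
    (hμ : ∀ i, μ i = ∫ ω, φ i (Z ω i) ∂P) {r : ℝ} (hr : 6 ≤ r)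
    (hmom : ∀ i, Integrable (fun ω => |φ i (Z ω i) - μ i| ^ r) P)
    {K : ℕ} (hK : 0 < K) (hRK : 4 * R ≤ K) {t : ℝ} (ht : 0 < t) :
    P.real {ω | t ≤ |∑ i, (φ i (Z ω i) - μ i)|} ≤
      K * √(80 * (∑ i, (2 + ∫ ω, |φ i (Z ω i) - μ i| ^ r ∂P)) ^ 3 / (t / K) ^ 6) := by
  have hpos : ∀ i, 0 < S i i := fun i => lt_of_le_of_ne hS.diag_nonneg (hdiag i).symm
  have hlaw : ∀ i, HasLaw (fun ω => Z ω i) (gaussianReal 0 (S i i).toNNReal) P := fun i =>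
    (measurePreserving_eval_multivariateGaussian (μ := 0) hS (i := i)).hasLaw.comp hZ
  -- Nonzero variance makes the marginal law absolutely continuous, so a Lebesgue measurable `φ i`
  -- can be replaced by a Borel version.
  have hφ' : ∀ i, AEMeasurable (φ i) (gaussianReal 0 (S i i).toNNReal) := fun i =>
    (hφ i).mono_ac (gaussianReal_absolutelyContinuous 0 (by simpa using hpos i))
  choose φ' hφ'm hφ'ae using hφ'
  set ψ : Fin n → ℝ → ℝ := fun i x => φ' i x - μ i with hψdef
  have hψ : ∀ i, Measurable (ψ i) := fun i => (hφ'm i).sub_const _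
  have hae : ∀ i, ∀ᵐ ω ∂P, φ i (Z ω i) - μ i = ψ i (Z ω i) := fun i => by
    have h := hφ'ae i
    rw [← (hlaw i).map_eq] at h
    filter_upwards [ae_of_ae_map (hlaw i).aemeasurable h] with ω hω
    simp only [hψdef, hω]
  have hmemP : ∀ i, MemLp (fun ω => ψ i (Z ω i)) 6 P := by
    intro i
    have hsm : AEStronglyMeasurable (fun ω => ψ i (Z ω i)) P :=
      ((hψ i).comp_aemeasurable (hlaw i).aemeasurable).aestronglyMeasurable
    have hr0 : ENNReal.ofReal r ≠ 0 := by
      simp only [ne_eq, ENNReal.ofReal_eq_zero, not_le]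
      linarith
    have h1 : MemLp (fun ω => ψ i (Z ω i)) (ENNReal.ofReal r) P := by
      rw [← integrable_norm_rpow_iff hsm hr0 ENNReal.ofReal_ne_top,
        ENNReal.toReal_ofReal (by linarith)]
      refine (hmom i).congr ?_
      filter_upwards [hae i] with ω hω
      rw [hω, Real.norm_eq_abs]
    refine h1.mono_exponent ?_
    rw [← ENNReal.ofReal_ofNat 6]
    exact ENNReal.ofReal_le_ofReal hr
  have h6 : ∀ i, MemLp (ψ i) 6 (gaussianReal 0 (S i i).toNNReal) := fun i => by
    rw [← (hlaw i).map_eq, memLp_map_measure_iff (hψ i).aestronglyMeasurable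
      (hlaw i).aemeasurable]
    exact hmemP i
  have h0 : ∀ i, ∫ x, ψ i x ∂gaussianReal 0 (S i i).toNNReal = 0 := fun i => by
    rw [← (hlaw i).map_eq, integral_map (hlaw i).aemeasurable (hψ i).aestronglyMeasurable,
      ← integral_congr_ae (hae i), integral_sub (hint i) (integrable_const _), ← hμ i]
    simp
  -- The `2` absorbs the `1` from `x⁶ ≤ 1 + |x|^r`, valid as `r ≥ 6`.
  have hc : ∀ i, 1 + ∫ x, ψ i x ^ 6 ∂gaussianReal 0 (S i i).toNNReal ≤
      2 + ∫ ω, |φ i (Z ω i) - μ i| ^ r ∂P := fun i => by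
    rw [← (hlaw i).map_eq, integral_map (hlaw i).aemeasurable
      ((hψ i).pow_const 6).aestronglyMeasurable]
    have h1 : ∫ ω, ψ i (Z ω i) ^ 6 ∂P ≤ ∫ ω, (1 + |φ i (Z ω i) - μ i| ^ r) ∂P := by
      refine integral_mono_ae (integrable_pow_of_memLp_six (hmemP i) le_rfl)
        ((integrable_const _).add (hmom i)) ?_
      filter_upwards [hae i] with ω hω
      rw [hω, ← Even.pow_abs (by decide)]
      have h2 := Real.rpow_nonneg (abs_nonneg (ψ i (Z ω i))) r
      rcases le_total |ψ i (Z ω i)| 1 with h | h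
      · have := pow_le_one₀ (n := 6) (abs_nonneg _) h
        linarith
      · have := Real.rpow_le_rpow_of_exponent_le h hr
        rw [show (6 : ℝ) = ((6 : ℕ) : ℝ) by norm_num, Real.rpow_natCast] at this
        linarith
    rw [integral_add (integrable_const _) (hmom i)] at h1
    simp at h1
    linarith
  -- Ordered pairs count each correlation twice, so the sum is at most `2 R ≤ K / 2`.
  have hsum : ∑ i, ∑ j, (if i = j then 0 else S i j ^ 2 / (S i i * S j j)) ≤ (K : ℝ) / 2 := by
    have h1 := Finset.sum_sum_Ioi_add_eq_sum_sum_off_diag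
      (fun i j : Fin n => S i j ^ 2 / (S i i * S j j))
    have hsymm : ∀ i j, S j i ^ 2 / (S j j * S i i) = S i j ^ 2 / (S i i * S j j) := fun i j => by
      rw [← hS.1.apply i j, mul_comm (S j j)]
      simp
    have h2 : ∑ i, ∑ j, (if i = j then 0 else S i j ^ 2 / (S i i * S j j)) =
        ∑ i, ∑ j ∈ {i}ᶜ, S j i ^ 2 / (S j j * S i i) := by
      refine Finset.sum_congr rfl fun i _ => ?_
      rw [← Finset.sum_add_sum_compl {i}, Finset.sum_singleton, if_pos rfl, zero_add]
      refine Finset.sum_congr rfl fun j hj => ?_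
      rw [if_neg, hsymm]
      rintro rfl
      simp at hj
    rw [h2, ← h1]
    simp_rw [hsymm, ← two_mul]
    simp_rw [← Finset.mul_sum]
    linarith
  have htail := multivariateGaussian_sum_tail hS hdiag K hK hsum ψ hψ h6 h0 _ hc ht
  refine le_trans (le_of_eq ?_) htail
  rw [← hZ.measureReal_eq (measurableSet_le measurable_const (by fun_prop))]
  refine measureReal_congr ?_
  filter_upwards [ae_all_iff.2 hae] with ω hω
  apply propext
  change t ≤ _ ↔ t ≤ _
  simp_rw [hω]

theorem mainTheorem5
    {Ω : Type*} [MeasurableSpace Ω] (P : Measure Ω) [IsProbabilityMeasure P]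
    -- the rows `ζ n = (ζ n 1, …, ζ n n)`, with law `N(0, Σ n)`;
    -- nothing is assumed on the joint law of different rows
    (ζ : (n : ℕ) → Ω → EuclideanSpace ℝ (Fin n))
    (Sig : (n : ℕ) → Matrix (Fin n) (Fin n) ℝ)
    (hSig : ∀ n, 1 ≤ n → (Sig n).PosSemidef)
    (hdiag : ∀ n, 1 ≤ n → ∀ α : Fin n, Sig n α α ≠ 0)
    (hζ : ∀ n, 1 ≤ n → HasLaw (ζ n) (multivariateGaussian 0 (Sig n)) P)
    (R : ℝ) (hR : 0 < R)
    (hcorr : ∀ n, 1 ≤ n →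
      ∑ α : Fin n, ∑ β ∈ Finset.Ioi α, (Sig n α β) ^ 2 / (Sig n α α * Sig n β β) ≤ R)
    -- Lebesgue measurable functions with finite means `μ n α = E φ n α (ζ n α)`
    (φ : (n : ℕ) → Fin n → ℝ → ℝ)
    (hφ : ∀ n, 1 ≤ n → ∀ α : Fin n, AEMeasurable (φ n α) volume)
    (hint : ∀ n, 1 ≤ n → ∀ α : Fin n, Integrable (fun ω => φ n α (ζ n ω α)) P)
    (μ : (n : ℕ) → Fin n → ℝ)
    (hμ : ∀ n, 1 ≤ n → ∀ α : Fin n, μ n α = ∫ ω, φ n α (ζ n ω α) ∂P)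
    (hmoment :
      (∃ p S : ℝ, 6 ≤ p ∧ ∀ n, 1 ≤ n → ∀ α : Fin n,
        Integrable (fun ω => |φ n α (ζ n ω α) - μ n α| ^ (2 * p)) P ∧
        ∫ ω, |φ n α (ζ n ω α) - μ n α| ^ (2 * p) ∂P ≤ S) ∨
      (∃ q S : ℝ, 12 < q ∧ ∀ n, 1 ≤ n →
        (∀ α : Fin n, Integrable (fun ω => |φ n α (ζ n ω α) - μ n α| ^ (2 * q)) P) ∧
        (1 / (n : ℝ)) * ∑ α : Fin n, ∫ ω, |φ n α (ζ n ω α) - μ n α| ^ (2 * q) ∂P < S)) :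
    ∀ᵐ ω ∂P, Tendsto
      (fun n : ℕ => (1 / (n : ℝ)) * ∑ α : Fin n, (φ n α (ζ n ω α) - μ n α))
      atTop (𝓝 0) := by
  -- Both alternatives reduce to a bound on the average of absolute moments of one order `r ≥ 6`,
  -- with `r = 2 p` or `r = 2 q`.
  obtain ⟨r, S, hr, hmom, hS⟩ : ∃ r S : ℝ, 6 ≤ r ∧
      (∀ n, 1 ≤ n → ∀ α : Fin n, Integrable (fun ω => |φ n α (ζ n ω α) - μ n α| ^ r) P) ∧
      ∀ n, 1 ≤ n → ∑ α : Fin n, ∫ ω, |φ n α (ζ n ω α) - μ n α| ^ r ∂P ≤ n * S := by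
    rcases hmoment with ⟨p, S, hp, h⟩ | ⟨q, S, hq, h⟩
    · refine ⟨2 * p, S, by linarith, fun n hn α => (h n hn α).1, fun n hn => ?_⟩
      refine (Finset.sum_le_sum fun α _ => (h n hn α).2).trans ?_
      simp
    · refine ⟨2 * q, S, by linarith, fun n hn => (h n hn).1, fun n hn => ?_⟩
      have hn' : (0 : ℝ) < n := by exact_mod_cast hn
      have h1 := (h n hn).2.le
      rw [one_div, inv_mul_le_iff₀ hn'] at h1
      exact h1
  obtain ⟨K, hK⟩ := exists_nat_ge (4 * R)
  have hK0 : 0 < K := by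
    have : (0 : ℝ) < K := by linarith
    exact_mod_cast this
  have hK0' : (0 : ℝ) < K := by exact_mod_cast hK0
  -- Here `t = ε n` and the moment sum is at most `n (2 + S)`, so the root is of `n³ / n⁶`, which
  -- gives the exponent `-3/2`.
  refine ae_tendsto_zero_of_summable_tail fun ε hε =>
    ⟨fun n => K * √(80 * (2 + S) ^ 3 * K ^ 6 / ε ^ 6) * (n : ℝ) ^ (-(3 / 2) : ℝ),
      (Real.summable_nat_rpow.2 (by norm_num)).mul_left _, fun n hn => ?_⟩
  have hn' : (0 : ℝ) < n := by exact_mod_cast hn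
  have htail := sum_tail_of_hasLaw_multivariateGaussian (hSig n hn) (hdiag n hn) (hζ n hn)
    (hcorr n hn) (hφ n hn) (hint n hn) (hμ n hn) hr (hmom n hn) hK0 hK (mul_pos hε hn')
  have hset : {ω | ε ≤ |(1 / (n : ℝ)) * ∑ α : Fin n, (φ n α (ζ n ω α) - μ n α)|} =
      {ω | ε * n ≤ |∑ α : Fin n, (φ n α (ζ n ω α) - μ n α)|} := by
    ext ω
    simp only [Set.mem_ofPred_eq]
    rw [abs_mul, abs_of_pos (by positivity), one_div, ← div_eq_inv_mul, le_div_iff₀ hn']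
  rw [hset]
  refine htail.trans ?_
  change _ ≤ (K : ℝ) * √_ * _
  rw [mul_assoc (K : ℝ)]
  refine mul_le_mul_of_nonneg_left ?_ hK0'.le
  set T := ∑ α : Fin n, (2 + ∫ ω, |φ n α (ζ n ω α) - μ n α| ^ r ∂P) with hT
  have hT0 : 0 ≤ T := Finset.sum_nonneg fun α _ =>
    add_nonneg zero_le_two (integral_nonneg fun ω => by positivity)
  have hT1 : T ≤ n * (2 + S) := by
    rw [hT, Finset.sum_add_distrib, mul_add]
    refine add_le_add ?_ (hS n hn)
    simp
  have hrpow : (n : ℝ) ^ (-(3 / 2) : ℝ) = √((n : ℝ) ^ 3)⁻¹ := by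
    rw [Real.sqrt_eq_rpow, ← Real.rpow_natCast, ← Real.rpow_neg hn'.le, ← Real.rpow_mul hn'.le]
    norm_num
  rw [hrpow, ← Real.sqrt_mul' _ (by positivity)]
  refine Real.sqrt_le_sqrt ?_
  calc 80 * T ^ 3 / (ε * n / K) ^ 6 ≤ 80 * (n * (2 + S)) ^ 3 / (ε * n / K) ^ 6 := by gcongr
    _ = 80 * (2 + S) ^ 3 * K ^ 6 / ε ^ 6 * ((n : ℝ) ^ 3)⁻¹ := by
      field_simp
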